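/- Let $\alpha\in(0,1)$, $\kappa>0$ and $\nu>0$. There are constants $C_3'>0$ and $\delta>0$, depending only on $\alpha,\kappa,\nu$, such that the following holds. For every $M$ let $x^{(M)}\in\mathbb C^M$ have support $\mathcal I=\{i: x^{(M)}_i\neq 0\}$ of size $L=L^{(M)}$, and let $N=N^{(M)}$ be a number of measurements. Suppose that $L=o(M)$ as $M\to\infty$; that $L\,\mu(x^{(M)})^2=\kappa$ for all large $M$, where $\mu(x)=\min_{i:\,x_i\ne0}|x_i|$; that the power $\|x^{(M)}\|_2^2=P$ is constant for all large $M$; and that $$N\succ C_3'\,L\log(M-L),$$ where $f\succ g$ means that either $f=g=0$ or $f(M)/g(M)>1$ for all sufficiently large $M$. Let $A$ be an $N\times M$ matrix with i.i.d. $\mathcal N_{\mathbb C}(0,1)$ (circularly symmetric complex Gaussian) entries, let $n\sim\mathcal N_{\mathbb C}(0,\nu^2I_N)$ be noise independent of $A$, and let $y=Ax^{(M)}+n$. A set $J\subseteq\{1,\dots,M\}$ with $|J|=L$ is called $\delta$-jointly typical with $y$ if the matrix $A_J$ of the columns of $A$ with index in $J$ has rank $L$ and $$\Big|\tfrac1N\|\Pi^{\perp}_{A_J}y\|^2-\tfrac{N-L}{N}\nu^2\Big|<\delta,$$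 where $\Pi^\perp_{A_J}$ is the orthogonal projection onto the orthogonal complement of the column span of $A_J$. Let $\mathcal D$ be the joint typicality decoder, which from $A$ and $y$ outputs an index set $\mathcal D(y)$ that is $\delta$-jointly typical with $y$ whenever such a set exists (its choice being a function of the collection of all $\delta$-jointly typical sets; any such rule is allowed). Then recovery is asymptotically reliable with respect to Error Metric 2: with the error probability for a given matrix $$p_{\mathrm{err}}(A\mid x^{(M)})=\mathbb P_n\Big(\frac{|\mathcal D(y)\cap\mathcal I|}{|\mathcal I|}\le 1-\alpha\Big),$$ the average error probability satisfies $$p_{\mathrm{err}}(\mathcal D\mid x^{(M)})=\mathbb E_A\big[p_{\mathrm{err}}(A\mid x^{(M)})\big]\longrightarrow 0\qquad(M\to\infty).$$ -/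

import Mathlib

open MeasureTheory ProbabilityTheory Filter Topology Asymptotics
open scoped NNReal ENNReal Matrix

namespace SparseRecovery

/-! ### Sparse vectors -/

/-- The support of a vector `x ∈ ℂ^M`. -/
noncomputable def supp {M : ℕ} (x : Fin M → ℂ) : Finset (Fin M) :=
  Finset.univ.filter fun i => x i ≠ 0

/-- `μ(x)`, the smallest modulus of a non-zero coefficient of `x`
(for `x = 0` this infimum over the empty set is `0`). -/
noncomputable def minAbs {M : ℕ} (x : Fin M → ℂ) : ℝ :=
  ⨅ i : {i : Fin M // i ∈ supp x}, ‖x i‖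

/-- The total power `‖x‖₂²`. -/
noncomputable def power {M : ℕ} (x : Fin M → ℂ) : ℝ :=
  ∑ i, ‖x i‖ ^ 2

/-! ### Gaussian noise and Gaussian measurement matrices -/

/-- The circularly symmetric complex Gaussian law with mean `0` and variance `v`: the real and
the imaginary part are independent real centred Gaussians of variance `v / 2`. -/
noncomputable def complexGaussian (v : ℝ≥0) : Measure ℂ :=
  ((gaussianReal 0 (v / 2)).prod (gaussianReal 0 (v / 2))).map
    Complex.measurableEquivRealProd.symm

instance (v : ℝ≥0) : IsProbabilityMeasure (complexGaussian v) :=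
  Measure.isProbabilityMeasure_map Complex.measurableEquivRealProd.symm.measurable.aemeasurable

/-- The law of the noise vector: `N` independent entries of mean `0` and variance `ν²`. -/
noncomputable def noiseLaw (N : ℕ) (ν : ℝ) : Measure (Fin N → ℂ) :=
  Measure.pi fun _ => complexGaussian (Real.toNNReal (ν ^ 2))

/-- The law of the entries of an `N × M` matrix with independent entries of mean `0` and variance `1`. -/
noncomputable def matrixLaw (N M : ℕ) : Measure (Fin N → Fin M → ℂ) :=
  Measure.pi fun _ : Fin N => Measure.pi fun _ : Fin M => complexGaussian 1

/-! ### Decoders and their probability of error -/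

/-- A decoder knows the measurement matrix and the observed vector and outputs a set of indices,
the support of its estimate. -/
abbrev Decoder (N M : ℕ) : Type :=
  Matrix (Fin N) (Fin M) ℂ → (Fin N → ℂ) → Finset (Fin M)

/-- Success for Error Metric 2: more than a fraction `1 - α` of the support of `x` is contained
in the support `J` of the estimate. -/
def Metric2Success {M : ℕ} (α : ℝ) (x : Fin M → ℂ) (J : Finset (Fin M)) : Prop :=
  1 - α < ((J ∩ supp x).card : ℝ) / ((supp x).card : ℝ)

/-- The error probability for a given matrix `A`, with respect to the noise `n`, when
`y = A x + n` is observed. -/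
noncomputable def errGiven {N M : ℕ} (α ν : ℝ) (D : Decoder N M) (x : Fin M → ℂ)
    (A : Matrix (Fin N) (Fin M) ℂ) : ℝ≥0∞ :=
  noiseLaw N ν {n | ¬ Metric2Success α x (D A (A *ᵥ x + n))}

/-- The error probability averaged over all Gaussian measurement matrices. -/
noncomputable def avgErr {N M : ℕ} (α ν : ℝ) (D : Decoder N M) (x : Fin M → ℂ) : ℝ≥0∞ :=
  ∫⁻ a, errGiven α ν D x (Matrix.of a) ∂(matrixLaw N M)

/-! ### The joint typicality decoder -/

/-- The subspace of `ℂ^N` spanned by the columns of `A` with index in `J`. -/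
noncomputable def colSpan {N M : ℕ} (A : Matrix (Fin N) (Fin M) ℂ) (J : Finset (Fin M)) :
    Submodule ℂ (EuclideanSpace ℂ (Fin N)) :=
  Submodule.span ℂ ((fun j => WithLp.toLp 2 (fun i => A i j)) '' (J : Set (Fin M)))

/-- `‖Π^⊥ y‖²`, where `Π^⊥` is the orthogonal projection onto the orthogonal complement of the
span of the columns of `A` with index in `J`. -/
noncomputable def residual {N M : ℕ} (A : Matrix (Fin N) (Fin M) ℂ) (J : Finset (Fin M))
    (y : Fin N → ℂ) : ℝ :=
  ‖(colSpan A J)ᗮ.starProjection (WithLp.toLp 2 y)‖ ^ 2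

/-- `y` and the index set `J` of size `L` are `δ`-jointly typical. -/
def JointlyTypical {N M : ℕ} (ν δ : ℝ) (L : ℕ) (A : Matrix (Fin N) (Fin M) ℂ)
    (y : Fin N → ℂ) (J : Finset (Fin M)) : Prop :=
  J.card = L ∧ (A.submatrix id (fun j : J => (j : Fin M))).rank = L ∧
    |1 / (N : ℝ) * residual A J y - ((N : ℝ) - (L : ℝ)) / (N : ℝ) * ν ^ 2| < δ

open scoped Classical in
/-- The collection of all index sets that are `δ`-jointly typical with `y`. -/
noncomputable def typicalSets {N M : ℕ} (ν δ : ℝ) (L : ℕ) (A : Matrix (Fin N) (Fin M) ℂ)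
    (y : Fin N → ℂ) : Finset (Finset (Fin M)) :=
  Finset.univ.filter fun J => JointlyTypical ν δ L A y J

/-- A rule that picks a member of every non-empty collection of index sets (its value at the
empty collection is arbitrary). -/
structure TieBreak (M : ℕ) where
  pick : Finset (Finset (Fin M)) → Finset (Fin M)
  pick_mem : ∀ S : Finset (Finset (Fin M)), S.Nonempty → pick S ∈ S

open scoped Classical in
noncomputable instance (M : ℕ) : Inhabited (TieBreak M) :=
  ⟨⟨fun S => if h : S.Nonempty then h.choose else ∅, fun S h => by
    simpa [dif_pos h] using h.choose_spec⟩⟩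

/-- The joint typicality decoder with threshold `δ` for signals with `L` non-zero coefficients:
it outputs an index set that is `δ`-jointly typical with `y` whenever there is one, where `τ`
decides between several candidates. -/
noncomputable def jtDecoder {M : ℕ} (N : ℕ) (ν δ : ℝ) (L : ℕ) (τ : TieBreak M) : Decoder N M :=
  fun A y => τ.pick (typicalSets ν δ L A y)

/-! ### Asymptotic comparison -/

/-- `f ≻ g`: either `f = g = 0`, or `f / g > 1` from some point on. (No monotonicity of `f` and
`g` is required here.) -/
def AsympGT (f g : ℕ → ℝ) : Prop :=
  (f = 0 ∧ g = 0) ∨ ∃ M₀ : ℕ, ∀ M : ℕ, M₀ < M → 1 < f M / g M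

end SparseRecovery

namespace SparseRecovery

open scoped ComplexConjugate

/-! ### Complex Gaussian integrals -/

/-! Fix a candidate set J. Projecting orthogonally to the columns in J kills the part of `y` they
carry. What remains is the projection of an isotropic complex Gaussian vector, independent of those
columns, with variance v = ν² + ∑_{j∉J} |x_j|² per coordinate, onto a space of dimension at least N
− |J|. The Laplace transform of its squared norm is explicit, which gives the Chernoff bound
`measure_residual_le`.

A set failing the metric misses power at least ακ, so its v is at least ν² + ακ, while the true
support has v = ν². With δ = ακ/2, and outside a null set of rank-deficient matrices, an error
forces a small residual for the true support, a large noise norm, or a small residual for some wrong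
set (`mem_deviationSet_of_not_metric2Success`). Each of these has probability at most q^N B^L, where
q < 1 and B depend only on α, κ, ν. There are at most M^L wrong sets, and the union bound gives
`exists_avgErr_le`.

Since L = o(M), log(M − L) is eventually at least (log M)/2. A suitable C then yields q^N ≤ M^(−3L),
which beats M^L B^L and leaves at most 3/M. -/

lemma integral_cexp_complexGaussian (v : ℝ≥0) (z : ℂ) :
    ∫ g, Complex.exp (((conj z * g).re : ℂ) * Complex.I) ∂complexGaussian v =
      Complex.exp (-((v : ℝ) * ‖z‖ ^ 2 / 4 : ℝ)) := by
  rw [complexGaussian, integral_map_equiv]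
  have h : ∀ p : ℝ × ℝ, Complex.exp
      (((conj z * Complex.measurableEquivRealProd.symm p).re : ℂ) * Complex.I) =
      Complex.exp (z.re * p.1 * Complex.I) * Complex.exp (z.im * p.2 * Complex.I) := by
    intro p
    rw [← Complex.exp_add]
    congr 1
    simp [Complex.measurableEquivRealProd]
    ring
  simp_rw [h]
  rw [integral_prod_mul (fun x : ℝ => Complex.exp (z.re * x * Complex.I))
    (fun x : ℝ => Complex.exp (z.im * x * Complex.I)), ← charFun_apply_real,
    ← charFun_apply_real, charFun_gaussianReal, charFun_gaussianReal, ← Complex.exp_add]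
  congr 1
  rw [← Complex.normSq_eq_norm_sq, Complex.normSq_apply]
  push_cast
  ring

/-- No sign condition on `b` is needed: if 1 + 2bv ≤ 0 the integral diverges and both sides take the
default value 0. -/
lemma integral_exp_neg_mul_sq_gaussianReal {v : ℝ≥0} (hv : v ≠ 0) (b : ℝ) :
    ∫ x, Real.exp (-(b * x ^ 2)) ∂gaussianReal 0 v = (√(1 + 2 * b * v))⁻¹ := by
  have hv' : (0 : ℝ) < v := by positivity
  rw [integral_gaussianReal_eq_integral_smul hv]
  have h : ∀ x : ℝ, gaussianPDFReal 0 v x • Real.exp (-(b * x ^ 2)) =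
      (√(2 * Real.pi * v))⁻¹ * Real.exp (-((1 + 2 * b * v) / (2 * v)) * x ^ 2) := by
    intro x
    rw [gaussianPDFReal, smul_eq_mul, mul_assoc, ← Real.exp_add]
    congr 2
    field_simp
    ring
  simp_rw [h]
  rw [integral_const_mul, integral_gaussian, ← Real.sqrt_inv, ← Real.sqrt_mul (by positivity),
    ← Real.sqrt_inv]
  congr 1
  field_simp

/-- Negative `b` is allowed because the upper tail of the noise norm needs a positive exponential
moment. -/
lemma integral_exp_neg_mul_sq_complexGaussian {v : ℝ≥0} (hv : v ≠ 0) {b : ℝ}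
    (hb : 0 < 1 + b * v) :
    ∫ g, Real.exp (-(b * ‖g‖ ^ 2)) ∂complexGaussian v = (1 + b * v)⁻¹ := by
  rw [complexGaussian, integral_map_equiv]
  have h : ∀ p : ℝ × ℝ, Real.exp (-(b * ‖Complex.measurableEquivRealProd.symm p‖ ^ 2)) =
      Real.exp (-(b * p.1 ^ 2)) * Real.exp (-(b * p.2 ^ 2)) := by
    intro p
    rw [← Real.exp_add, ← Complex.normSq_eq_norm_sq, Complex.normSq_apply]
    congr 1
    simp [Complex.measurableEquivRealProd]
    ring
  have e : 1 + 2 * b * ((v / 2 : ℝ≥0) : ℝ) = 1 + b * v := by push_cast; ring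
  simp_rw [h]
  rw [integral_prod_mul (fun x : ℝ => Real.exp (-(b * x ^ 2)))
    (fun x : ℝ => Real.exp (-(b * x ^ 2))),
    integral_exp_neg_mul_sq_gaussianReal (by simpa using hv), e,
    ← mul_inv, Real.mul_self_sqrt hb.le]

/-- The Laplace transform of the squared norm of the projection of an isotropic complex Gaussian
vector, which is given by its characteristic function. -/
lemma integral_exp_neg_mul_sq_starProjection {Ω E : Type*} [MeasurableSpace Ω]
    [NormedAddCommGroup E] [InnerProductSpace ℂ E] [FiniteDimensional ℂ E] [MeasurableSpace E]
    [BorelSpace E] {ρ : Measure Ω} [IsProbabilityMeasure ρ] {W : Ω → E} (hW : Measurable W)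
    {σ : ℝ} (hσ : 0 ≤ σ)
    (hchar : ∀ h : E, ∫ ω, Complex.exp (((inner ℂ h (W ω)).re : ℂ) * Complex.I) ∂ρ =
      Complex.exp (-(σ * ‖h‖ ^ 2 / 4 : ℝ)))
    (K : Submodule ℂ E) {s : ℝ} (hs : 0 < s) :
    ∫ ω, Real.exp (-(s * ‖K.starProjection (W ω)‖ ^ 2)) ∂ρ =
      ((1 + s * σ) ^ Module.finrank ℂ K)⁻¹ := by
  have : SecondCountableTopology E := by
    have := FiniteDimensional.proper ℂ E
    infer_instance
  set u := stdOrthonormalBasis ℂ K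
  set d := Module.finrank ℂ K
  -- The characteristic function of variance v is exp(−v|z|²/4), so v = 4s makes exp(−s‖Πw‖²) the
  -- characteristic function at w of an auxiliary Gaussian vector in K. Exchanging the two integrals
  -- then brings in `hchar`.
  set v : ℝ≥0 := ⟨4 * s, by positivity⟩
  have hvs : (v : ℝ) = 4 * s := rfl
  set γ : Measure (Fin d → ℂ) := Measure.pi fun _ => complexGaussian v
  set G : (Fin d → ℂ) → E := fun g => ∑ k, g k • (u k : E)
  have hGmeas : Measurable G := by
    have : Continuous G := by fun_prop
    exact this.measurable
  have hG : ∀ g, ‖G g‖ ^ 2 = ∑ k, ‖g k‖ ^ 2 := by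
    intro g
    have : G g = ((∑ k, g k • u k : K) : E) := by simp [G]
    rw [this, Submodule.norm_coe, ← u.sum_sq_norm_inner_right]
    simp [inner_sum, inner_smul_right, orthonormal_iff_ite.mp u.orthonormal]
  have hproj : ∀ w : E, (Real.exp (-(s * ‖K.starProjection w‖ ^ 2)) : ℂ) =
      ∫ g, Complex.exp (((inner ℂ (G g) w).re : ℂ) * Complex.I) ∂γ := by
    intro w
    have h1 : ∀ g : Fin d → ℂ, Complex.exp (((inner ℂ (G g) w).re : ℂ) * Complex.I) =
        ∏ k, Complex.exp (((conj (inner ℂ (u k : E) w) * g k).re : ℂ) * Complex.I) := by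
      intro g
      rw [← Complex.exp_sum, ← Finset.sum_mul, ← Complex.ofReal_sum, ← Complex.re_sum]
      congr 3
      rw [← Complex.conj_re]
      congr 1
      simp [G, map_sum, mul_comm]
    simp_rw [h1]
    rw [integral_fintype_prod_eq_prod (f := fun k (x : ℂ) =>
      Complex.exp (((conj (inner ℂ (u k : E) w) * x).re : ℂ) * Complex.I))]
    simp_rw [integral_cexp_complexGaussian]
    rw [← Complex.exp_sum, Complex.ofReal_exp]
    congr 1
    simp_rw [← Complex.ofReal_neg]
    rw [← Complex.ofReal_sum, Finset.sum_neg_distrib, Submodule.starProjection_apply,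
      Submodule.norm_coe, ← u.sum_sq_norm_inner_right, Finset.mul_sum]
    congr 2
    refine Finset.sum_congr rfl fun k _ => ?_
    rw [hvs, Submodule.inner_orthogonalProjectionOnto_eq_of_mem_left]
    ring
  have hint : Integrable (Function.uncurry fun (ω : Ω) (g : Fin d → ℂ) =>
      Complex.exp (((inner ℂ (G g) (W ω)).re : ℂ) * Complex.I)) (ρ.prod γ) := by
    refine Integrable.of_bound (C := 1) ?_ (ae_of_all _ fun p => ?_)
    · refine Measurable.aestronglyMeasurable ?_
      simp only [Function.uncurry_def]
      fun_prop
    · simp [Function.uncurry_def, Complex.norm_exp_ofReal_mul_I]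
  apply Complex.ofReal_injective
  rw [← integral_complex_ofReal]
  simp_rw [hproj]
  rw [integral_integral_swap hint]
  simp_rw [hchar]
  have h2 : ∀ g : Fin d → ℂ, Complex.exp (-((σ * ‖G g‖ ^ 2 / 4 : ℝ) : ℂ)) =
      ((∏ k, Real.exp (-(σ / 4 * ‖g k‖ ^ 2)) : ℝ) : ℂ) := by
    intro g
    rw [hG, ← Real.exp_sum, Complex.ofReal_exp]
    congr 1
    rw [← Complex.ofReal_neg, Finset.sum_neg_distrib, ← Finset.mul_sum]
    congr 2
    ring
  simp_rw [h2]
  rw [integral_complex_ofReal, integral_fintype_prod_eq_pow (f := fun x : ℂ => 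
    Real.exp (-(σ / 4 * ‖x‖ ^ 2))), integral_exp_neg_mul_sq_complexGaussian]
  · have : σ / 4 * (v : ℝ) = s * σ := by rw [hvs]; ring
    simp [this]
  · exact fun h => by simp [h] at hvs; linarith
  · rw [hvs]; positivity

/-! ### Resampling columns of the measurement matrix -/

lemma map_prod_pi {ι α β γ : Type*} [Fintype ι] [MeasurableSpace α] [MeasurableSpace β]
    [MeasurableSpace γ] (μ : ι → Measure α) (ν : ι → Measure β) [∀ i, IsProbabilityMeasure (μ i)]
    [∀ i, IsProbabilityMeasure (ν i)] {f : ι → α × β → γ} (hf : ∀ i, Measurable (f i)) :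
    ((Measure.pi μ).prod (Measure.pi ν)).map (fun p i => f i (p.1 i, p.2 i)) =
      Measure.pi fun i => ((μ i).prod (ν i)).map (f i) := by
  have : ∀ i, IsProbabilityMeasure (((μ i).prod (ν i)).map (f i)) := fun i =>
    Measure.isProbabilityMeasure_map (hf i).aemeasurable
  rw [← (measurePreserving_arrowProdEquivProdArrow α β ι μ ν).map_eq, Measure.map_map
    (by fun_prop) (MeasurableEquiv.measurable _), ← Measure.pi_map_pi fun i => (hf i).aemeasurable]
  rfl

instance (N M : ℕ) : IsProbabilityMeasure (matrixLaw N M) := by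
  unfold matrixLaw; infer_instance

instance (N : ℕ) (ν : ℝ) : IsProbabilityMeasure (noiseLaw N ν) := by
  unfold noiseLaw; infer_instance

/-- The matrix with the columns of `a` inside `J` and the columns of `b` outside `J`. -/
def spliceCols {N M : ℕ} (J : Finset (Fin M)) (a b : Fin N → Fin M → ℂ) : Fin N → Fin M → ℂ :=
  fun i j => if j ∈ J then a i j else b i j

lemma measurable_spliceCols {N M : ℕ} (J : Finset (Fin M)) :
    Measurable fun p : (Fin N → Fin M → ℂ) × (Fin N → Fin M → ℂ) => spliceCols J p.1 p.2 := by
  refine measurable_pi_lambda _ fun i => measurable_pi_lambda _ fun j => ?_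
  by_cases h : j ∈ J <;> simp only [spliceCols, h, if_true, if_false] <;> fun_prop

lemma map_spliceCols_matrixLaw {N M : ℕ} (J : Finset (Fin M)) :
    ((matrixLaw N M).prod (matrixLaw N M)).map (fun p => spliceCols J p.1 p.2) =
      matrixLaw N M := by
  let f : Fin M → ℂ × ℂ → ℂ := fun j p => if j ∈ J then p.1 else p.2
  have hf : ∀ j, Measurable (f j) := fun j => by
    by_cases h : j ∈ J <;> simp only [f, h, if_true, if_false] <;> fun_prop
  have hrow : ((Measure.pi fun _ : Fin M => complexGaussian 1).prod
      (Measure.pi fun _ : Fin M => complexGaussian 1)).map (fun p j => f j (p.1 j, p.2 j)) =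
      Measure.pi fun _ : Fin M => complexGaussian 1 := by
    rw [map_prod_pi _ _ hf]
    congr 1
    ext1 j
    by_cases h : j ∈ J
    · simp only [f, h, if_true]
      exact measurePreserving_fst.map_eq
    · simp only [f, h, if_false]
      exact measurePreserving_snd.map_eq
  have hg : Measurable fun (p : (Fin M → ℂ) × (Fin M → ℂ)) j => f j (p.1 j, p.2 j) := by
    fun_prop
  have h := map_prod_pi (fun _ : Fin N => Measure.pi fun _ : Fin M => complexGaussian 1)
    (fun _ : Fin N => Measure.pi fun _ : Fin M => complexGaussian 1) (fun _ => hg)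
  rw [hrow] at h
  exact h

/-- Columns are independent, so those outside J may be redrawn. This separates the randomness
defining the projection from the randomness being projected, and Fubini replaces conditioning. -/
lemma measurePreserving_spliceCols {N M : ℕ} (J : Finset (Fin M)) (ν : ℝ) :
    MeasurePreserving
      (fun p : (Fin N → Fin M → ℂ) × ((Fin N → Fin M → ℂ) × (Fin N → ℂ)) =>
        (spliceCols J p.1 p.2.1, p.2.2))
      ((matrixLaw N M).prod ((matrixLaw N M).prod (noiseLaw N ν)))
      ((matrixLaw N M).prod (noiseLaw N ν)) :=
  ((⟨measurable_spliceCols J, map_spliceCols_matrixLaw J⟩ : MeasurePreserving _ _ _).prod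
    (MeasurePreserving.id (noiseLaw N ν))).comp
    (measurePreserving_prodAssoc (matrixLaw N M) (matrixLaw N M) (noiseLaw N ν)).symm

/-! ### The observed vector -/

/-- By independence the exponential factors over all entries of the matrix and the noise. The answer
depends on `h` only through its norm, which is the isotropy used later. -/
lemma integral_cexp_inner_mulVec_add {N M : ℕ} (ν : ℝ) (z : Fin M → ℂ)
    (h : EuclideanSpace ℂ (Fin N)) :
    ∫ p, Complex.exp (((inner ℂ h (WithLp.toLp 2 (Matrix.of p.1 *ᵥ z + p.2))).re : ℂ) *
        Complex.I) ∂(matrixLaw N M).prod (noiseLaw N ν) =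
      Complex.exp (-((∑ j, ‖z j‖ ^ 2 + ν ^ 2) * ‖h‖ ^ 2 / 4 : ℝ)) := by
  have hsplit : ∀ p : (Fin N → Fin M → ℂ) × (Fin N → ℂ),
      Complex.exp (((inner ℂ h (WithLp.toLp 2 (Matrix.of p.1 *ᵥ z + p.2))).re : ℂ) *
        Complex.I) =
      (∏ i, ∏ j, Complex.exp (((conj (h i * conj (z j)) * p.1 i j).re : ℂ) * Complex.I)) *
        ∏ i, Complex.exp (((conj (h i) * p.2 i).re : ℂ) * Complex.I) := by
    intro p
    simp_rw [← Complex.exp_sum, ← Complex.exp_add, ← Finset.sum_mul, ← add_mul,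
      ← Complex.ofReal_sum, ← Complex.ofReal_add, ← Complex.re_sum, ← Complex.add_re]
    congr 4
    rw [← Finset.sum_add_distrib]
    simp only [PiLp.inner_apply, RCLike.inner_apply, Pi.add_apply, Matrix.mulVec, dotProduct,
      Matrix.of_apply, map_mul, Complex.conj_conj, add_mul, Finset.sum_mul]
    refine Finset.sum_congr rfl fun i _ => ?_
    congr 1
    · exact Finset.sum_congr rfl fun j _ => by ring
    · ring
  simp_rw [hsplit]
  rw [integral_prod_mul
    (fun a : Fin N → Fin M → ℂ =>
      ∏ i, ∏ j, Complex.exp (((conj (h i * conj (z j)) * a i j).re : ℂ) * Complex.I))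
    (fun n : Fin N → ℂ => ∏ i, Complex.exp (((conj (h i) * n i).re : ℂ) * Complex.I)),
    matrixLaw, noiseLaw, integral_fintype_prod_eq_prod (f := fun i (a : Fin M → ℂ) =>
      ∏ j, Complex.exp (((conj (h i * conj (z j)) * a j).re : ℂ) * Complex.I)),
    integral_fintype_prod_eq_prod (f := fun i (n : ℂ) =>
      Complex.exp (((conj (h i) * n).re : ℂ) * Complex.I))]
  have hrow : ∀ i, ∫ a : Fin M → ℂ,
      ∏ j, Complex.exp (((conj (h i * conj (z j)) * a j).re : ℂ) * Complex.I)
        ∂(Measure.pi fun _ : Fin M => complexGaussian 1) =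
      ∏ j, ∫ g, Complex.exp (((conj (h i * conj (z j)) * g).re : ℂ) * Complex.I)
        ∂complexGaussian 1 := fun i =>
    integral_fintype_prod_eq_prod (f := fun j (g : ℂ) =>
      Complex.exp (((conj (h i * conj (z j)) * g).re : ℂ) * Complex.I))
  simp_rw [hrow, integral_cexp_complexGaussian, ← Complex.exp_sum]
  rw [← Complex.exp_add]
  congr 1
  simp_rw [← Complex.ofReal_neg]
  simp_rw [← Complex.ofReal_sum]
  rw [← Complex.ofReal_add]
  congr 1
  rw [EuclideanSpace.norm_sq_eq, Real.coe_toNNReal _ (sq_nonneg ν), ← Finset.sum_add_distrib,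
    Finset.mul_sum, Finset.sum_div, ← Finset.sum_neg_distrib]
  refine Finset.sum_congr rfl fun i _ => ?_
  simp only [norm_mul, RCLike.norm_conj, mul_pow, NNReal.coe_one, one_mul, add_mul, add_div,
    Finset.sum_mul, Finset.sum_div, neg_add, Finset.sum_neg_distrib]
  congr 2
  exact Finset.sum_congr rfl fun j _ => by ring

/-! ### The residual -/

variable {N M : ℕ}

lemma colSpan_congr {A B : Matrix (Fin N) (Fin M) ℂ} {J : Finset (Fin M)}
    (h : ∀ i, ∀ j ∈ J, A i j = B i j) : colSpan A J = colSpan B J := by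
  unfold colSpan
  congr 1
  refine Set.image_congr fun j hj => ?_
  congr 1
  ext i
  exact h i j hj

lemma mem_colSpan_iff {A : Matrix (Fin N) (Fin M) ℂ} {J : Finset (Fin M)}
    {w : EuclideanSpace ℂ (Fin N)} :
    w ∈ colSpan A J ↔
      ∃ c : Fin M → ℂ, w = WithLp.toLp 2 (fun i => ∑ j ∈ J, c j * A i j) := by
  have hsum (c : Fin M → ℂ) : ∑ j ∈ J, c j • WithLp.toLp 2 (fun i => A i j) =
      (WithLp.toLp 2 (fun i => ∑ j ∈ J, c j * A i j) : EuclideanSpace ℂ (Fin N)) := by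
    ext i
    simp
  simp_rw [← hsum]
  rw [colSpan, Submodule.mem_span_image_finset_iff_exists_fun']
  exact exists_congr fun c => eq_comm

/-- The residual is a squared distance to the column span, hence an infimum over coefficient
vectors. This makes its strict sublevel sets unions of open sets, which gives measurability without
any formula for the projection. -/
lemma residual_lt_iff {A : Matrix (Fin N) (Fin M) ℂ} {J : Finset (Fin M)} {y : Fin N → ℂ}
    {t : ℝ} : residual A J y < t ↔ ∃ c : Fin M → ℂ,
      ‖(WithLp.toLp 2 (fun i => y i - ∑ j ∈ J, c j * A i j) : EuclideanSpace ℂ (Fin N))‖ ^ 2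
        < t := by
  have hval : residual A J y =
      ‖WithLp.toLp 2 y - (colSpan A J).starProjection (WithLp.toLp 2 y)‖ ^ 2 := by
    rw [residual, Submodule.starProjection_orthogonal_val]
  constructor
  · intro h
    obtain ⟨c, hc⟩ := mem_colSpan_iff.mp
      ((colSpan A J).starProjection_apply_mem (WithLp.toLp 2 y))
    refine ⟨c, ?_⟩
    rw [hval, hc, ← WithLp.toLp_sub] at h
    exact h
  · rintro ⟨c, hc⟩
    refine lt_of_le_of_lt ?_ hc
    rw [hval, Submodule.starProjection_minimal]
    refine pow_le_pow_left₀ (Real.iInf_nonneg fun _ => norm_nonneg _) ?_ 2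
    have hmem : WithLp.toLp 2 (fun i => ∑ j ∈ J, c j * A i j) ∈ colSpan A J :=
      mem_colSpan_iff.mpr ⟨c, rfl⟩
    have hle := ciInf_le (f := fun w : colSpan A J =>
      ‖(WithLp.toLp 2 y : EuclideanSpace ℂ (Fin N)) - w‖)
      ⟨0, by rintro _ ⟨w, rfl⟩; exact norm_nonneg _⟩ ⟨_, hmem⟩
    exact hle

lemma measurable_residual (J : Finset (Fin M)) :
    Measurable fun p : (Fin N → Fin M → ℂ) × (Fin N → ℂ) => residual (Matrix.of p.1) J p.2 := by
  refine measurable_of_Iio fun t => IsOpen.measurableSet ?_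
  have : (fun p : (Fin N → Fin M → ℂ) × (Fin N → ℂ) => residual (Matrix.of p.1) J p.2) ⁻¹'
      Set.Iio t = ⋃ c : Fin M → ℂ, {p | ‖(WithLp.toLp 2 (fun i => p.2 i - ∑ j ∈ J, c j * p.1 i j) :
        EuclideanSpace ℂ (Fin N))‖ ^ 2 < t} := by
    ext p
    simp [residual_lt_iff]
  rw [this]
  refine isOpen_iUnion fun c => isOpen_lt ?_ continuous_const
  simp_rw [EuclideanSpace.norm_sq_eq]
  fun_prop

lemma measurable_residual_mulVec_add (J : Finset (Fin M)) (z : Fin M → ℂ) :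
    Measurable fun p : (Fin N → Fin M → ℂ) × (Fin N → ℂ) =>
      residual (Matrix.of p.1) J (Matrix.of p.1 *ᵥ z + p.2) := by
  refine (measurable_residual J).comp (g := fun p => residual (Matrix.of p.1) J p.2)
    (f := fun p : (Fin N → Fin M → ℂ) × (Fin N → ℂ) => (p.1, Matrix.of p.1 *ᵥ z + p.2)) ?_
  refine measurable_fst.prodMk (Continuous.measurable ?_)
  refine continuous_pi fun i => ?_
  simp only [Pi.add_apply, Matrix.mulVec, dotProduct, Matrix.of_apply]
  fun_prop

lemma residual_nonneg (A : Matrix (Fin N) (Fin M) ℂ) (J : Finset (Fin M)) (y : Fin N → ℂ) :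
    0 ≤ residual A J y := sq_nonneg _

lemma residual_le_norm_sq (A : Matrix (Fin N) (Fin M) ℂ) (J : Finset (Fin M)) (y : Fin N → ℂ) :
    residual A J y ≤ ∑ i, ‖y i‖ ^ 2 := by
  rw [residual, show ∑ i, ‖y i‖ ^ 2 = ‖(WithLp.toLp 2 y : EuclideanSpace ℂ (Fin N))‖ ^ 2 by
    rw [EuclideanSpace.norm_sq_eq]]
  gcongr
  exact Submodule.norm_starProjection_apply_le _ _

lemma residual_mulVec_add (A : Matrix (Fin N) (Fin M) ℂ) (J : Finset (Fin M)) (z : Fin M → ℂ)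
    (y : Fin N → ℂ) (hz : ∀ j ∉ J, z j = 0) : residual A J (A *ᵥ z + y) = residual A J y := by
  have hmem : (WithLp.toLp 2 (A *ᵥ z) : EuclideanSpace ℂ (Fin N)) ∈ colSpan A J := by
    refine mem_colSpan_iff.mpr ⟨z, ?_⟩
    congr 1
    ext i
    rw [Matrix.mulVec, dotProduct, ← Finset.sum_subset (Finset.subset_univ J)]
    · exact Finset.sum_congr rfl fun j _ => mul_comm _ _
    · intro j _ hj
      rw [hz j hj, mul_zero]
  rw [residual, WithLp.toLp_add, map_add,
    Submodule.starProjection_orthogonal_apply_eq_zero hmem, zero_add, residual]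

/-- An inequality valid for every matrix suffices for the Laplace bound, so no generic-rank
statement is needed there. -/
lemma le_finrank_orthogonal_colSpan (A : Matrix (Fin N) (Fin M) ℂ) (J : Finset (Fin M)) :
    N ≤ J.card + Module.finrank ℂ (colSpan A J)ᗮ := by
  have h1 := (colSpan A J).finrank_add_finrank_orthogonal
  have h2 : Module.finrank ℂ (colSpan A J) ≤ J.card := by
    classical
    rw [colSpan, ← Finset.coe_image]
    exact (finrank_span_finset_le_card _).trans Finset.card_image_le
  rw [finrank_euclideanSpace_fin] at h1
  omega

lemma residual_spliceCols (J : Finset (Fin M)) (a b : Fin N → Fin M → ℂ) (z : Fin M → ℂ)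
    (n : Fin N → ℂ) :
    residual (Matrix.of (spliceCols J a b)) J (Matrix.of (spliceCols J a b) *ᵥ z + n) =
      ‖(colSpan (Matrix.of a) J)ᗮ.starProjection
        (WithLp.toLp 2 (Matrix.of b *ᵥ (fun j => if j ∈ J then 0 else z j) + n))‖ ^ 2 := by
  have hcol : colSpan (Matrix.of (spliceCols J a b)) J = colSpan (Matrix.of a) J :=
    colSpan_congr fun i j hj => by simp [spliceCols, hj]
  have hy : Matrix.of (spliceCols J a b) *ᵥ z + n =
      Matrix.of (spliceCols J a b) *ᵥ (fun j => if j ∈ J then z j else 0) +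
        (Matrix.of b *ᵥ (fun j => if j ∈ J then 0 else z j) + n) := by
    rw [← add_assoc]
    congr 1
    ext i
    simp only [Pi.add_apply, Matrix.mulVec, dotProduct, Matrix.of_apply, spliceCols]
    rw [← Finset.sum_add_distrib]
    refine Finset.sum_congr rfl fun j _ => ?_
    split_ifs <;> simp
  rw [hy, residual_mulVec_add _ _ _ _ fun j hj => if_neg hj, residual]
  simp only [hcol]

/-- The Laplace transform of the residual. -/
lemma mgf_residual_le (ν : ℝ) (J : Finset (Fin M)) (z : Fin M → ℂ) {s : ℝ} (hs : 0 < s) :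
    mgf (fun p : (Fin N → Fin M → ℂ) × (Fin N → ℂ) =>
        residual (Matrix.of p.1) J (Matrix.of p.1 *ᵥ z + p.2))
        ((matrixLaw N M).prod (noiseLaw N ν)) (-s) ≤
      (1 + s * (∑ j ∈ Jᶜ, ‖z j‖ ^ 2 + ν ^ 2)) ^ J.card /
        (1 + s * (∑ j ∈ Jᶜ, ‖z j‖ ^ 2 + ν ^ 2)) ^ N := by
  set v := ∑ j ∈ Jᶜ, ‖z j‖ ^ 2 + ν ^ 2 with hv
  have hv0 : 0 ≤ v := add_nonneg (Finset.sum_nonneg fun _ _ => sq_nonneg _) (sq_nonneg _)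
  have hB : 1 ≤ 1 + s * v := by nlinarith [mul_nonneg hs.le hv0]
  have hF : Measurable fun p : (Fin N → Fin M → ℂ) × (Fin N → ℂ) =>
      Real.exp (-s * residual (Matrix.of p.1) J (Matrix.of p.1 *ᵥ z + p.2)) :=
    Real.measurable_exp.comp ((measurable_residual_mulVec_add J z).const_mul _)
  have hmp := measurePreserving_spliceCols (N := N) J ν
  rw [mgf, ← hmp.map_eq, integral_map hmp.measurable.aemeasurable hF.aestronglyMeasurable,
    integral_prod]
  swap
  · refine Integrable.of_bound (C := 1) (hF.comp hmp.measurable).aestronglyMeasurable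
      (ae_of_all _ fun p => ?_)
    rw [Real.norm_eq_abs, Real.abs_exp, Real.exp_le_one_iff]
    exact mul_nonpos_of_nonpos_of_nonneg (by linarith) (residual_nonneg _ _ _)
  set z' : Fin M → ℂ := fun j => if j ∈ J then 0 else z j
  have hz' : ∑ j, ‖z' j‖ ^ 2 + ν ^ 2 = v := by
    rw [hv, ← Finset.sum_add_sum_compl J, Finset.sum_eq_zero, zero_add]
    · congr 1
      refine Finset.sum_congr rfl fun j hj => ?_
      simp [z', Finset.mem_compl.mp hj]
    · intro j hj
      simp [z', hj]
  have hinner : ∀ a : Fin N → Fin M → ℂ,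
      ∫ q : (Fin N → Fin M → ℂ) × (Fin N → ℂ),
        Real.exp (-s * residual (Matrix.of (spliceCols J a q.1)) J
          (Matrix.of (spliceCols J a q.1) *ᵥ z + q.2)) ∂(matrixLaw N M).prod (noiseLaw N ν) =
      ((1 + s * v) ^ Module.finrank ℂ (colSpan (Matrix.of a) J)ᗮ)⁻¹ := by
    intro a
    simp_rw [residual_spliceCols, neg_mul]
    refine integral_exp_neg_mul_sq_starProjection
      (W := fun q : (Fin N → Fin M → ℂ) × (Fin N → ℂ) =>
        (WithLp.toLp 2 (Matrix.of q.1 *ᵥ z' + q.2) : EuclideanSpace ℂ (Fin N))) ?_ hv0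
      (fun h => ?_) _ hs
    · refine (WithLp.measurable_toLp _ _).comp (Continuous.measurable ?_)
      refine continuous_pi fun i => ?_
      simp only [Pi.add_apply, Matrix.mulVec, dotProduct, Matrix.of_apply]
      fun_prop
    · rw [integral_cexp_inner_mulVec_add, hz']
  simp_rw [hinner]
  refine (integral_mono_of_nonneg (ae_of_all _ fun a => by positivity) (integrable_const
    ((1 + s * v) ^ J.card / (1 + s * v) ^ N)) (ae_of_all _ fun a => ?_)).trans (by simp)
  rw [inv_eq_one_div]
  refine (div_le_div_iff₀ (by positivity) (by positivity)).mpr ?_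
  rw [one_mul, ← pow_add]
  exact pow_le_pow_right₀ hB (le_finrank_orthogonal_colSpan _ _)

/-- The Chernoff bound for the lower tail of the residual. -/
lemma measure_residual_le (ν : ℝ) (J : Finset (Fin M)) (z : Fin M → ℂ) {s : ℝ} (hs : 0 < s)
    (t : ℝ) :
    ((matrixLaw N M).prod (noiseLaw N ν)).real
        {p | residual (Matrix.of p.1) J (Matrix.of p.1 *ᵥ z + p.2) ≤ t} ≤
      Real.exp (s * t) * ((1 + s * (∑ j ∈ Jᶜ, ‖z j‖ ^ 2 + ν ^ 2)) ^ J.card /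
        (1 + s * (∑ j ∈ Jᶜ, ‖z j‖ ^ 2 + ν ^ 2)) ^ N) := by
  refine (measure_le_le_exp_mul_mgf t (neg_nonpos.mpr hs.le) ?_).trans ?_
  · refine Integrable.of_bound (C := 1) (Real.measurable_exp.comp
      ((measurable_residual_mulVec_add J z).const_mul _)).aestronglyMeasurable
      (ae_of_all _ fun p => ?_)
    rw [Real.norm_eq_abs, Real.abs_exp, Real.exp_le_one_iff]
    exact mul_nonpos_of_nonpos_of_nonneg (by linarith) (residual_nonneg _ _ _)
  · rw [neg_neg]
    gcongr
    exact mgf_residual_le ν J z hs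

/-- The Chernoff bound for the upper tail of the squared norm of the noise. -/
lemma measure_le_norm_sq_noise {ν : ℝ} (hν : ν ≠ 0) {s : ℝ} (hs : 0 < s) (hsν : s * ν ^ 2 < 1)
    (t : ℝ) :
    (noiseLaw N ν).real {n | t ≤ ∑ i, ‖n i‖ ^ 2} ≤
      Real.exp (-s * t) * ((1 - s * ν ^ 2)⁻¹) ^ N := by
  have hv : Real.toNNReal (ν ^ 2) ≠ 0 := by
    simpa using hν
  have hb : 0 < 1 + (-s) * (Real.toNNReal (ν ^ 2) : ℝ) := by
    rw [Real.coe_toNNReal _ (sq_nonneg ν)]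
    linarith
  have hone := integral_exp_neg_mul_sq_complexGaussian hv hb
  have hsum : ∀ n : Fin N → ℂ, Real.exp (s * ∑ i, ‖n i‖ ^ 2) =
      ∏ i, Real.exp (-(-s * ‖n i‖ ^ 2)) := by
    intro n
    rw [← Real.exp_sum, Finset.mul_sum]
    simp
  have hint1 : Integrable (fun g : ℂ => Real.exp (-(-s * ‖g‖ ^ 2)))
      (complexGaussian (Real.toNNReal (ν ^ 2))) := by
    -- A non-integrable function would have integral 0 by convention, whereas the closed form is
    -- positive.
    refine Integrable.of_integral_ne_zero ?_
    rw [hone]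
    positivity
  refine (measure_ge_le_exp_mul_mgf t hs.le ?_).trans ?_
  · simp_rw [hsum]
    exact Integrable.fintype_prod (fun _ => hint1)
  · rw [mgf]
    simp_rw [hsum]
    rw [noiseLaw, integral_fintype_prod_eq_pow (f := fun g : ℂ => Real.exp (-(-s * ‖g‖ ^ 2))),
      hone, Real.coe_toNNReal _ (sq_nonneg ν)]
    simp [sub_eq_add_neg]

/-! ### Gaussian columns are almost surely linearly independent -/

/-- Lets the noisy tail bounds be specialised to a noiseless column. -/
lemma noiseLaw_zero (N : ℕ) : noiseLaw N 0 = Measure.dirac 0 := by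
  have h : complexGaussian 0 = Measure.dirac 0 := by
    rw [complexGaussian, zero_div, gaussianReal_zero_var, Measure.dirac_prod_dirac,
      Measure.map_dirac' (MeasurableEquiv.measurable _)]
    rfl
  simp only [noiseLaw, ne_eq, OfNat.ofNat_ne_zero, not_false_eq_true, zero_pow,
    Real.toNNReal_zero, h]
  refine Measure.pi_eq fun s hs => ?_
  rw [Measure.dirac_apply' _ (MeasurableSet.univ_pi hs)]
  simp_rw [Measure.dirac_apply' _ (hs _)]
  by_cases h : ∀ i, (0 : ℂ) ∈ s i
  · simp [h]
  · obtain ⟨i, hi⟩ := not_forall.mp h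
    rw [Set.indicator_of_notMem (fun h0 => hi (Set.mem_univ_pi.mp h0 i)),
      Finset.prod_eq_zero (Finset.mem_univ i) (Set.indicator_of_notMem hi _)]

/-- Apply the Chernoff bound with ν = 0, signal e_j and threshold 0: the variance is 1, and since
|J| < N the bound is at most 1/(1 + s), which vanishes as s → ∞. -/
lemma ae_residual_col_pos {J : Finset (Fin M)} (hJ : J.card < N) {j : Fin M} (hj : j ∉ J) :
    ∀ᵐ a ∂matrixLaw N M, 0 < residual (Matrix.of a) J (fun i => a i j) := by
  classical
  have hsum : ∑ k ∈ Jᶜ, ‖(Pi.single j (1 : ℂ) : Fin M → ℂ) k‖ ^ 2 + (0 : ℝ) ^ 2 = 1 := by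
    rw [Finset.sum_eq_single_of_mem j (Finset.mem_compl.mpr hj)]
    · simp
    · intro k _ hk
      simp [Pi.single_eq_of_ne hk]
  set S : Set ((Fin N → Fin M → ℂ) × (Fin N → ℂ)) := {p | residual (Matrix.of p.1) J
    (Matrix.of p.1 *ᵥ (Pi.single j 1 : Fin M → ℂ) + p.2) ≤ 0} with hS
  have hSm : MeasurableSet S := measurable_residual_mulVec_add J _ measurableSet_Iic
  have hle : ∀ s : ℝ, 0 < s → ((matrixLaw N M).prod (noiseLaw N 0)).real S ≤ (1 + s)⁻¹ := by
    intro s hs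
    refine (measure_residual_le 0 J (Pi.single j 1) hs 0).trans ?_
    rw [hsum, mul_zero, Real.exp_zero, one_mul, mul_one, inv_eq_one_div]
    refine (div_le_div_iff₀ (by positivity) (by positivity)).mpr ?_
    rw [one_mul, ← pow_succ]
    exact pow_le_pow_right₀ (by linarith) hJ
  have hlim : Tendsto (fun s : ℝ => (1 + s)⁻¹) atTop (𝓝 0) :=
    tendsto_inv_atTop_zero.comp (tendsto_atTop_add_const_left _ _ tendsto_id)
  have hzero : ((matrixLaw N M).prod (noiseLaw N 0)).real S = 0 :=
    le_antisymm (ge_of_tendsto hlim ((eventually_gt_atTop 0).mono hle)) measureReal_nonneg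
  rw [measureReal_eq_zero_iff, noiseLaw_zero, Measure.prod_dirac, Measure.map_apply
    (by fun_prop) hSm] at hzero
  refine measure_mono_null (fun a ha => ?_) hzero
  simp only [Set.mem_compl_iff, Set.mem_ofPred_eq, not_lt] at ha
  simp only [hS, Set.mem_preimage, Set.mem_ofPred_eq, add_zero, Matrix.mulVec_single_one]
  exact ha

lemma residual_eq_zero_of_mem {A : Matrix (Fin N) (Fin M) ℂ} {J : Finset (Fin M)}
    {y : Fin N → ℂ} (h : WithLp.toLp 2 y ∈ colSpan A J) : residual A J y = 0 := by
  rw [residual, Submodule.starProjection_orthogonal_apply_eq_zero h]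
  simp

lemma ae_rank_submatrix_eq {I : Finset (Fin M)} (hI : I.card ≤ N) :
    ∀ᵐ a ∂matrixLaw N M,
      ((Matrix.of a).submatrix id (fun j : I => (j : Fin M))).rank = I.card := by
  classical
  have hpos : ∀ᵐ a ∂matrixLaw N M, ∀ j : I,
      0 < residual (Matrix.of a) (I.erase j) (fun i => a i j) := by
    refine ae_all_iff.mpr fun j => ae_residual_col_pos ?_ (Finset.notMem_erase _ _)
    exact (Finset.card_erase_lt_of_mem j.2).trans_le hI
  filter_upwards [hpos] with a ha
  have hli : LinearIndependent ℂ fun j : I =>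
      (WithLp.toLp 2 (fun i => a i j) : EuclideanSpace ℂ (Fin N)) := by
    refine linearIndependent_iff_notMem_span.mpr fun j hj => (ha j).ne' ?_
    refine residual_eq_zero_of_mem (Submodule.span_mono ?_ hj)
    rintro _ ⟨k, hk, rfl⟩
    refine ⟨k, ?_, rfl⟩
    simp only [Set.mem_sdiff, Set.mem_univ, Set.mem_singleton_iff, true_and] at hk
    exact Finset.mem_coe.mpr (Finset.mem_erase.mpr ⟨fun h => hk (Subtype.ext h), k.2⟩)
  have hli' : LinearIndependent ℂ ((Matrix.of a).submatrix id (fun j : I => (j : Fin M))).col :=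
    hli.map' (WithLp.linearEquiv 2 ℂ (Fin N → ℂ)).toLinearMap (LinearEquiv.ker _)
  rw [Matrix.rank_eq_finrank_span_cols, finrank_span_eq_card hli', Fintype.card_coe]

/-! ### Reduction of the error event to deviations of residuals -/

lemma minAbs_sq_le {x : Fin M → ℂ} {i : Fin M} (hi : i ∈ supp x) : minAbs x ^ 2 ≤ ‖x i‖ ^ 2 := by
  refine pow_le_pow_left₀ (Real.iInf_nonneg fun _ => norm_nonneg _) ?_ 2
  exact ciInf_le (f := fun i : {i : Fin M // i ∈ supp x} => ‖x i‖)
    ⟨0, by rintro _ ⟨w, rfl⟩; exact norm_nonneg _⟩ ⟨i, hi⟩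

/-- At least αL support indices are missed, each of power at least μ², and αLμ² = ακ. -/
lemma le_sum_sq_compl_of_not_metric2Success {α κ : ℝ} {x : Fin M → ℂ} {J : Finset (Fin M)}
    (hx : ((supp x).card : ℝ) * minAbs x ^ 2 = κ) (hx0 : 0 < (supp x).card)
    (h : ¬ Metric2Success α x J) : α * κ ≤ ∑ j ∈ Jᶜ, ‖x j‖ ^ 2 := by
  have hL : (0 : ℝ) < (supp x).card := by exact_mod_cast hx0
  rw [Metric2Success, not_lt, div_le_iff₀ hL, Finset.inter_comm] at h
  have hcard : ((supp x \ J).card : ℝ) + ((supp x ∩ J).card : ℝ) = (supp x).card := by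
    exact_mod_cast Finset.card_sdiff_add_card_inter _ _
  calc α * κ = α * (supp x).card * minAbs x ^ 2 := by rw [← hx]; ring
    _ ≤ (supp x \ J).card * minAbs x ^ 2 := by
      gcongr
      linarith
    _ = ∑ j ∈ supp x \ J, minAbs x ^ 2 := by simp
    _ ≤ ∑ j ∈ supp x \ J, ‖x j‖ ^ 2 :=
      Finset.sum_le_sum fun j hj => minAbs_sq_le (Finset.mem_sdiff.mp hj).1
    _ ≤ ∑ j ∈ Jᶜ, ‖x j‖ ^ 2 :=
      Finset.sum_le_sum_of_subset_of_nonneg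
        (fun j hj => Finset.mem_compl.mpr (Finset.mem_sdiff.mp hj).2) fun _ _ _ => sq_nonneg _

/-- The candidate supports that miss at least the power `η` of the signal. -/
noncomputable def wrongSupports (η : ℝ) (x : Fin M → ℂ) : Finset (Finset (Fin M)) :=
  (Finset.univ.powersetCard (supp x).card).filter fun J => η ≤ ∑ j ∈ Jᶜ, ‖x j‖ ^ 2

lemma card_wrongSupports_le (η : ℝ) (x : Fin M → ℂ) :
    (wrongSupports η x).card ≤ M ^ (supp x).card := by
  refine (Finset.card_filter_le _ _).trans ?_
  rw [Finset.card_powersetCard, Finset.card_univ, Fintype.card_fin]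
  exact Nat.choose_le_pow _ _

/-- The deviations that have to occur for the decoder to fail. -/
def deviationSet (N : ℕ) (ν δ η : ℝ) (x : Fin M → ℂ) :
    Set ((Fin N → Fin M → ℂ) × (Fin N → ℂ)) :=
  ({p | residual (Matrix.of p.1) (supp x) (Matrix.of p.1 *ᵥ x + p.2) ≤ N * (ν ^ 2 - δ)} ∪
    Set.univ ×ˢ {n | N * (ν ^ 2 + δ) - (supp x).card * ν ^ 2 ≤ ∑ i, ‖n i‖ ^ 2}) ∪
  ⋃ J ∈ wrongSupports η x,
    {p | residual (Matrix.of p.1) J (Matrix.of p.1 *ᵥ x + p.2) ≤ N * (ν ^ 2 + δ)}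

lemma measurableSet_deviationSet (ν δ η : ℝ) (x : Fin M → ℂ) :
    MeasurableSet (deviationSet N ν δ η x) := by
  refine MeasurableSet.union (MeasurableSet.union ?_ (MeasurableSet.univ.prod ?_))
    (Finset.measurableSet_biUnion _ fun J _ => ?_)
  · exact measurable_residual_mulVec_add _ _ measurableSet_Iic
  · exact measurableSet_le measurable_const (by fun_prop)
  · exact measurable_residual_mulVec_add _ _ measurableSet_Iic

lemma mem_deviationSet_of_not_metric2Success {α κ ν δ : ℝ} {x : Fin M → ℂ} (hN : 0 < N)
    (hx : ((supp x).card : ℝ) * minAbs x ^ 2 = κ) (hx0 : 0 < (supp x).card) (τ : TieBreak M)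
    {a : Fin N → Fin M → ℂ} {n : Fin N → ℂ}
    (hrank : ((Matrix.of a).submatrix id (fun j : supp x => (j : Fin M))).rank = (supp x).card)
    (h : ¬ Metric2Success α x
      (jtDecoder N ν δ (supp x).card τ (Matrix.of a) (Matrix.of a *ᵥ x + n))) :
    (a, n) ∈ deviationSet N ν δ (α * κ) x := by
  have hN' : (0 : ℝ) < N := by exact_mod_cast hN
  have hscale : ∀ r : ℝ, 1 / (N : ℝ) * r - ((N : ℝ) - ((supp x).card : ℝ)) / N * ν ^ 2 =
      (r - ((N : ℝ) - ((supp x).card : ℝ)) * ν ^ 2) / N := fun r => by ring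
  have hLν : 0 ≤ ((supp x).card : ℝ) * ν ^ 2 := by positivity
  by_cases hI : JointlyTypical ν δ (supp x).card (Matrix.of a) (Matrix.of a *ᵥ x + n) (supp x)
  · right
    set J := jtDecoder N ν δ (supp x).card τ (Matrix.of a) (Matrix.of a *ᵥ x + n) with hJdef
    have hJ : JointlyTypical ν δ (supp x).card (Matrix.of a) (Matrix.of a *ᵥ x + n) J := by
      have := τ.pick_mem (typicalSets ν δ (supp x).card (Matrix.of a) (Matrix.of a *ᵥ x + n))
        ⟨supp x, by simpa [typicalSets] using hI⟩
      classical exact (Finset.mem_filter.mp this).2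
    refine Set.mem_biUnion (x := J) ?_ ?_
    · simp only [wrongSupports, Finset.coe_filter, Set.mem_ofPred_eq,
        Finset.mem_powersetCard_univ]
      exact ⟨hJ.1, le_sum_sq_compl_of_not_metric2Success hx hx0 h⟩
    · have := (abs_lt.mp hJ.2.2).2
      rw [hscale, div_lt_iff₀ hN'] at this
      simp only [Set.mem_ofPred_eq]
      linarith
  · left
    have hdev : ¬ |1 / (N : ℝ) * residual (Matrix.of a) (supp x) (Matrix.of a *ᵥ x + n) -
        ((N : ℝ) - ((supp x).card : ℝ)) / N * ν ^ 2| < δ := fun hlt => hI ⟨rfl, hrank, hlt⟩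
    rw [hscale, not_lt, le_abs] at hdev
    rcases hdev with hup | hlow
    · right
      refine ⟨Set.mem_univ _, ?_⟩
      rw [le_div_iff₀ hN', residual_mulVec_add _ _ _ _ (by simp [supp])] at hup
      -- The projection of the noise is bounded by the whole noise. This lowers the threshold
      -- relative to the mean Nν² by Lν², at the cost of the factor `B₃ ^ L` in the tail bound.
      have := residual_le_norm_sq (Matrix.of a) (supp x) n
      simp only [Set.mem_ofPred_eq]
      linarith
    · left
      rw [← neg_div, le_div_iff₀ hN'] at hlow
      simp only [Set.mem_ofPred_eq]
      linarith

/-- Only the deviation set has to be measurable: for almost every matrix its slice contains the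
error event, and monotonicity of the measure does the rest. -/
lemma avgErr_le_deviationSet {α κ ν δ : ℝ} {x : Fin M → ℂ} (hN : (supp x).card ≤ N)
    (hx : ((supp x).card : ℝ) * minAbs x ^ 2 = κ) (hx0 : 0 < (supp x).card) (τ : TieBreak M) :
    avgErr α ν (jtDecoder N ν δ (supp x).card τ) x ≤
      ((matrixLaw N M).prod (noiseLaw N ν)) (deviationSet N ν δ (α * κ) x) := by
  rw [Measure.prod_apply (measurableSet_deviationSet _ _ _ _), avgErr]
  refine lintegral_mono_ae ?_
  filter_upwards [ae_rank_submatrix_eq hN] with a ha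
  exact measure_mono fun n hn =>
    mem_deviationSet_of_not_metric2Success (hx0.trans_le hN) hx hx0 τ ha hn

/-! ### Exponential bounds -/

/-- To first order exp(sa) is 1 + sa, with error at most (sa)² when |sa| ≤ 1; the two terms of the
minimum ensure this and sa² < b − a. -/
lemma exists_exp_mul_lt {a b : ℝ} (h : a < b) : ∃ s : ℝ, 0 < s ∧ Real.exp (s * a) < 1 + s * b := by
  have hba : 0 < b - a := sub_pos.mpr h
  refine ⟨min (1 / (|a| + 1)) ((b - a) / (a ^ 2 + 1) / 2), by positivity, ?_⟩
  set s := min (1 / (|a| + 1)) ((b - a) / (a ^ 2 + 1) / 2)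
  have hs : 0 < s := by positivity
  have h1 : |s * a| ≤ 1 := by
    rw [abs_mul, abs_of_pos hs]
    have : s ≤ 1 / (|a| + 1) := min_le_left _ _
    rw [le_div_iff₀ (by positivity)] at this
    linarith
  have h2 : s * a ^ 2 < b - a := by
    have : s ≤ (b - a) / (a ^ 2 + 1) / 2 := min_le_right _ _
    rw [div_div, le_div_iff₀ (by positivity)] at this
    nlinarith [mul_nonneg hs.le (sq_nonneg a)]
  have h3 := (abs_le.mp (Real.abs_exp_sub_one_sub_id_le h1)).2
  nlinarith [mul_lt_mul_of_pos_left h2 hs]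

/-- As |J| ≤ N, the Chernoff bound decreases in the variance, so a lower bound `v` may replace it
uniformly over J. -/
lemma measureReal_residual_le_pow {ν s a v : ℝ} {J : Finset (Fin M)} {x : Fin M → ℂ}
    (hs : 0 < s) (hv : 0 ≤ v) (hvx : v ≤ ∑ j ∈ Jᶜ, ‖x j‖ ^ 2 + ν ^ 2) (hJ : J.card ≤ N) :
    ((matrixLaw N M).prod (noiseLaw N ν)).real
        {p | residual (Matrix.of p.1) J (Matrix.of p.1 *ᵥ x + p.2) ≤ N * a} ≤
      (Real.exp (s * a) / (1 + s * v)) ^ N * (1 + s * v) ^ J.card := by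
  have hsv : 0 ≤ s * v := mul_nonneg hs.le hv
  refine (measure_residual_le ν J x hs (N * a)).trans ?_
  have hB : 1 + s * v ≤ 1 + s * (∑ j ∈ Jᶜ, ‖x j‖ ^ 2 + ν ^ 2) := by gcongr
  rw [div_pow, ← Real.exp_nat_mul, show s * (N * a) = N * (s * a) by ring, div_mul_eq_mul_div,
    mul_div_assoc]
  gcongr _ * ?_
  obtain ⟨d, rfl⟩ := Nat.exists_eq_add_of_le hJ
  have h0 : 0 < 1 + s * v := by linarith
  have h1 := h0.trans_le hB
  rw [pow_add, pow_add, ← div_div, ← div_div, div_self (by positivity), div_self (by positivity)]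
  gcongr

/-- The average error probability is at most exponentially small in the number of measurements,
up to a factor that is exponential in `L log M`. -/
lemma exists_avgErr_le {α κ ν : ℝ} (hα : 0 < α) (hκ : 0 < κ) (hν : 0 < ν) :
    ∃ δ : ℝ, 0 < δ ∧ ∃ q B : ℝ, 0 < q ∧ q < 1 ∧ 1 ≤ B ∧ ∀ (N M : ℕ) (x : Fin M → ℂ),
      (supp x).card ≤ N → ((supp x).card : ℝ) * minAbs x ^ 2 = κ → 0 < (supp x).card →
      ∀ τ : TieBreak M, avgErr α ν (jtDecoder N ν δ (supp x).card τ) x ≤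
        ENNReal.ofReal (((M : ℝ) ^ (supp x).card + 2) * (q ^ N * B ^ (supp x).card)) := by
  have hακ : 0 < α * κ := mul_pos hα hκ
  have hν2 : 0 < ν ^ 2 := by positivity
  -- Chernoff parameters for the three deviations: small residual of a wrong set, small residual of
  -- the true support, and large noise norm (hence the negated values). The threshold δ = ακ/2 lies
  -- halfway between the levels ν² and ν² + ακ.
  obtain ⟨s₁, hs₁, h₁⟩ := exists_exp_mul_lt
    (show ν ^ 2 + α * κ / 2 < ν ^ 2 + α * κ by linarith)
  obtain ⟨s₂, hs₂, h₂⟩ := exists_exp_mul_lt (show ν ^ 2 - α * κ / 2 < ν ^ 2 by linarith)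
  obtain ⟨s₃, hs₃, h₃⟩ := exists_exp_mul_lt (show -(ν ^ 2 + α * κ / 2) < -ν ^ 2 by linarith)
  set B₁ := 1 + s₁ * (ν ^ 2 + α * κ)
  set B₂ := 1 + s₂ * ν ^ 2
  set B₃ := Real.exp (s₃ * ν ^ 2)
  set q₁ := Real.exp (s₁ * (ν ^ 2 + α * κ / 2)) / B₁
  set q₂ := Real.exp (s₂ * (ν ^ 2 - α * κ / 2)) / B₂
  set q₃ := Real.exp (s₃ * -(ν ^ 2 + α * κ / 2)) / (1 + s₃ * -ν ^ 2)
  have hB₁ : 0 < B₁ := (Real.exp_pos _).trans h₁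
  have hB₂ : 0 < B₂ := (Real.exp_pos _).trans h₂
  have hB₃ : 0 < B₃ := Real.exp_pos _
  have hD : 0 < 1 + s₃ * -ν ^ 2 := (Real.exp_pos _).trans h₃
  have hq₁ : 0 < q₁ := by positivity
  have hq₂ : 0 < q₂ := by positivity
  have hq₃ : 0 < q₃ := by positivity
  refine ⟨α * κ / 2, by positivity, max q₁ (max q₂ q₃), max 1 (max B₁ (max B₂ B₃)),
    lt_max_of_lt_left hq₁, ?_, le_max_left _ _, ?_⟩
  · exact max_lt ((div_lt_one hB₁).mpr h₁)
      (max_lt ((div_lt_one hB₂).mpr h₂) ((div_lt_one hD).mpr h₃))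
  intro N M x hN hx hx0 τ
  set q := max q₁ (max q₂ q₃)
  set B := max 1 (max B₁ (max B₂ B₃))
  have hq1 : q₁ ≤ q := le_max_left _ _
  have hq2 : q₂ ≤ q := (le_max_left _ _).trans (le_max_right _ _)
  have hq3 : q₃ ≤ q := (le_max_right _ _).trans (le_max_right _ _)
  have hb1 : B₁ ≤ B := (le_max_left _ _).trans (le_max_right _ _)
  have hb2 : B₂ ≤ B := (le_max_left _ _).trans ((le_max_right _ _).trans (le_max_right _ _))
  have hb3 : B₃ ≤ B := (le_max_right _ _).trans ((le_max_right _ _).trans (le_max_right _ _))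
  set L := (supp x).card
  refine (avgErr_le_deviationSet hN hx hx0 τ).trans ?_
  rw [← ofReal_measureReal]
  refine ENNReal.ofReal_le_ofReal ?_
  have hlow : ((matrixLaw N M).prod (noiseLaw N ν)).real {p | residual (Matrix.of p.1) (supp x)
      (Matrix.of p.1 *ᵥ x + p.2) ≤ N * (ν ^ 2 - α * κ / 2)} ≤ q ^ N * B ^ L := by
    refine (measureReal_residual_le_pow hs₂ hν2.le ?_ hN).trans ?_
    · have : 0 ≤ ∑ j ∈ (supp x)ᶜ, ‖x j‖ ^ 2 := by positivity
      linarith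
    · change q₂ ^ N * B₂ ^ L ≤ _
      gcongr
  have hup : ((matrixLaw N M).prod (noiseLaw N ν)).real (Set.univ ×ˢ
      {n | N * (ν ^ 2 + α * κ / 2) - L * ν ^ 2 ≤ ∑ i, ‖n i‖ ^ 2}) ≤ q ^ N * B ^ L := by
    rw [measureReal_prod_prod, probReal_univ, one_mul]
    refine (measure_le_norm_sq_noise hν.ne' hs₃ (by linarith) _).trans ?_
    have : Real.exp (-s₃ * (N * (ν ^ 2 + α * κ / 2) - L * ν ^ 2)) * ((1 - s₃ * ν ^ 2)⁻¹) ^ N =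
        q₃ ^ N * B₃ ^ L := by
      simp only [q₃, B₃]
      rw [div_pow, ← Real.exp_nat_mul, ← Real.exp_nat_mul, div_mul_eq_mul_div, ← Real.exp_add,
        inv_pow, ← div_eq_mul_inv, show 1 + s₃ * -ν ^ 2 = 1 - s₃ * ν ^ 2 by ring]
      congr 2
      ring
    rw [this]
    gcongr
  have hwrong : ((matrixLaw N M).prod (noiseLaw N ν)).real
      (⋃ J ∈ wrongSupports (α * κ) x, {p | residual (Matrix.of p.1) J
        (Matrix.of p.1 *ᵥ x + p.2) ≤ N * (ν ^ 2 + α * κ / 2)}) ≤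
      (M : ℝ) ^ L * (q ^ N * B ^ L) := by
    refine (measureReal_biUnion_finset_le _ _).trans ?_
    have hterm : ∀ J ∈ wrongSupports (α * κ) x,
        ((matrixLaw N M).prod (noiseLaw N ν)).real {p | residual (Matrix.of p.1) J
          (Matrix.of p.1 *ᵥ x + p.2) ≤ N * (ν ^ 2 + α * κ / 2)} ≤ q ^ N * B ^ L := by
      intro J hJ
      simp only [wrongSupports, Finset.mem_filter, Finset.mem_powersetCard_univ] at hJ
      refine (measureReal_residual_le_pow hs₁ (v := ν ^ 2 + α * κ) (by positivity) ?_
        (hJ.1.trans_le hN)).trans ?_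
      · linarith [hJ.2]
      · rw [hJ.1]
        change q₁ ^ N * B₁ ^ L ≤ _
        gcongr
    refine (Finset.sum_le_card_nsmul _ _ _ hterm).trans ?_
    rw [nsmul_eq_mul]
    gcongr
    exact_mod_cast card_wrongSupports_le _ x
  calc ((matrixLaw N M).prod (noiseLaw N ν)).real (deviationSet N ν (α * κ / 2) (α * κ) x)
      ≤ (q ^ N * B ^ L + q ^ N * B ^ L) + (M : ℝ) ^ L * (q ^ N * B ^ L) :=
        (measureReal_union_le _ _).trans
          (add_le_add ((measureReal_union_le _ _).trans (add_le_add hlow hup)) hwrong)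
    _ = ((M : ℝ) ^ L + 2) * (q ^ N * B ^ L) := by ring

/-! ### Asymptotics -/

/-- Here m − l ≥ m/2 ≥ √m, the last step using m ≥ 4. -/
lemma half_log_le_log_sub {m l : ℝ} (hm : 4 ≤ m) (hl : 2 * l ≤ m) :
    Real.log m / 2 ≤ Real.log (m - l) := by
  rw [div_le_iff₀ two_pos, mul_comm, ← Real.log_rpow (by linarith)]
  refine Real.log_le_log (by linarith) ?_
  norm_num
  nlinarith

/-- The decay M^(−3L) pays M^L for the number of sets and M^L for B^L, leaving one factor M^(−L). -/
lemma add_two_mul_pow_mul_pow_le {q B : ℝ} (hq : 0 < q) (hB : 0 ≤ B) {M L N : ℕ}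
    (hM : 0 < M) (hBM : B ≤ M) (hL : 0 < L) (hN : 3 * (L * Real.log M) ≤ -Real.log q * N) :
    ((M : ℝ) ^ L + 2) * (q ^ N * B ^ L) ≤ 3 / M := by
  have hM' : (1 : ℝ) ≤ M := by exact_mod_cast hM
  have hM0 : (0 : ℝ) < M := by linarith
  have hqN : q ^ N ≤ ((M : ℝ) ^ (3 * L))⁻¹ := by
    rw [← Real.log_le_log_iff (by positivity) (by positivity), Real.log_inv, Real.log_pow,
      Real.log_pow]
    push_cast
    linarith
  have h1 : (1 : ℝ) ≤ (M : ℝ) ^ L := one_le_pow₀ hM'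
  have h2 : (M : ℝ) ≤ (M : ℝ) ^ L := le_self_pow₀ hM' hL.ne'
  calc ((M : ℝ) ^ L + 2) * (q ^ N * B ^ L)
      ≤ (3 * (M : ℝ) ^ L) * (((M : ℝ) ^ (3 * L))⁻¹ * (M : ℝ) ^ L) := by
        gcongr
        linarith
    _ = 3 / (M : ℝ) ^ L := by
        rw [mul_comm 3 L, pow_mul]
        field_simp
    _ ≤ 3 / M := by gcongr

end SparseRecovery

theorem mainTheorem9 (α κ ν : ℝ) (hα : α ∈ Set.Ioo (0 : ℝ) 1) (hκ : 0 < κ) (hν : 0 < ν) :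
    ∃ C : ℝ, 0 < C ∧ ∃ δ : ℝ, 0 < δ ∧
      ∀ (P : ℝ) (L N : ℕ → ℕ) (x : ∀ M : ℕ, Fin M → ℂ),
        (∀ M, (SparseRecovery.supp (x M)).card = L M) →
        (fun M => (L M : ℝ)) =o[atTop] (fun M => (M : ℝ)) →
        (∀ᶠ M in atTop, (L M : ℝ) * SparseRecovery.minAbs (x M) ^ 2 = κ) →
        (∀ᶠ M in atTop, SparseRecovery.power (x M) = P) →
        SparseRecovery.AsympGT (fun M => (N M : ℝ))
          (fun M => C * (L M : ℝ) * Real.log ((M : ℝ) - (L M : ℝ))) →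
        ∀ τ : ∀ M : ℕ, SparseRecovery.TieBreak M,
          Tendsto (fun M => SparseRecovery.avgErr α ν
            (SparseRecovery.jtDecoder (N M) ν δ (L M) (τ M)) (x M)) atTop (𝓝 0) := by
  obtain ⟨δ, hδ, q, B, hq0, hq1, hB, herr⟩ := SparseRecovery.exists_avgErr_le hα.1 hκ hν
  have hlq : 0 < -Real.log q := neg_pos.mpr (Real.log_neg hq0 hq1)
  -- The 6 is 3 · 2: three multiples of L log M are needed, and passing from log(M − L) to log M
  -- costs a factor 2.
  refine ⟨6 / -Real.log q, by positivity, δ, hδ, ?_⟩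
  set C := 6 / -Real.log q with hC
  have hC0 : 0 < C := by positivity
  intro P L N x hL hLM hκx _ hN τ
  have hLpos : ∀ᶠ M in atTop, 0 < L M := by
    filter_upwards [hκx] with M hM
    refine Nat.pos_of_ne_zero fun h0 => hκ.ne ?_
    simpa [h0] using hM
  have hLhalf : ∀ᶠ M in atTop, 2 * (L M : ℝ) ≤ M := by
    filter_upwards [hLM.def (show (0 : ℝ) < 1 / 2 by norm_num)] with M hM
    simp only [Real.norm_natCast] at hM
    linarith
  have hcast := tendsto_natCast_atTop_atTop (R := ℝ)
  -- Makes C(log M)/2 ≥ 1, which later forces L ≤ N.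
  have hlog : ∀ᶠ M : ℕ in atTop, 2 / C ≤ Real.log M :=
    (Real.tendsto_log_atTop.comp hcast).eventually_ge_atTop _
  have hNbig : ∀ᶠ M in atTop,
      C * (L M : ℝ) * Real.log ((M : ℝ) - (L M : ℝ)) ≤ N M := by
    rcases hN with ⟨hN0, hg0⟩ | ⟨M₀, hM₀⟩
    -- In the degenerate case both sides are 0, so the same non-strict inequality serves both cases.
    · exact Eventually.of_forall fun M => ((congrFun hg0 M).trans (congrFun hN0 M).symm).le
    · filter_upwards [eventually_gt_atTop M₀, hLpos, hLhalf, hlog,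
        hcast.eventually_ge_atTop 4] with M hM hLp hLh hlg hM4
      have h1 := SparseRecovery.half_log_le_log_sub hM4 hLh
      have h2 : 0 < 2 / C := by positivity
      have h3 : 0 < Real.log ((M : ℝ) - (L M : ℝ)) := by linarith
      have hLp' : (0 : ℝ) < L M := by exact_mod_cast hLp
      exact ((one_lt_div (by positivity)).mp (hM₀ M hM)).le
  have hbound : ∀ᶠ M in atTop, SparseRecovery.avgErr α ν
      (SparseRecovery.jtDecoder (N M) ν δ (L M) (τ M)) (x M) ≤ ENNReal.ofReal (3 / M) := by
    filter_upwards [hκx, hLpos, hLhalf, hlog, hNbig, hcast.eventually_ge_atTop 4,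
      hcast.eventually_ge_atTop B] with M hκM hLp hLh hlg hNM hM4 hBM
    have hhalf := SparseRecovery.half_log_le_log_sub hM4 hLh
    have hLp' : (0 : ℝ) < L M := by exact_mod_cast hLp
    have hCN : C * (L M * (Real.log M / 2)) ≤ N M := by
      refine le_trans ?_ hNM
      rw [mul_assoc]
      gcongr
    have hLN : L M ≤ N M := by
      rw [div_le_iff₀ hC0] at hlg
      have : (L M : ℝ) ≤ N M := by nlinarith
      exact_mod_cast this
    have h := herr (N M) M (x M) ((hL M).trans_le hLN) (by rw [hL M]; exact hκM)
      (by rw [hL M]; exact hLp) (τ M)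
    rw [hL M] at h
    refine h.trans (ENNReal.ofReal_le_ofReal ?_)
    refine SparseRecovery.add_two_mul_pow_mul_pow_le hq0 (by linarith) ?_ hBM hLp ?_
    · have : (0 : ℝ) < M := by linarith
      exact_mod_cast this
    · have h6 : -Real.log q * C = 6 := by rw [hC, mul_div_cancel₀ _ hlq.ne']
      have := mul_le_mul_of_nonneg_left hCN hlq.le
      rw [← mul_assoc, h6] at this
      linarith
  have hlim : Tendsto (fun M : ℕ => ENNReal.ofReal (3 / (M : ℝ))) atTop (𝓝 0) := by
    have := ENNReal.tendsto_ofReal (tendsto_const_div_atTop_nhds_zero_nat (3 : ℝ))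
    rwa [ENNReal.ofReal_zero] at this
  exact tendsto_of_tendsto_of_tendsto_of_le_of_le' tendsto_const_nhds hlim
    (Eventually.of_forall fun _ => zero_le) hbound
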